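/- Let $\mathcal I\subset\mathbb R$ be a nonempty interval, let $f:\mathcal I\to\mathbb R$ be continuous and strictly increasing, and let $\{X_n : n\ge 1\}$ be i.i.d. $\mathcal I$-valued random variables on a probability space $(\Omega,\mathcal F,\mathbb P)$, with $X$ denoting a random variable having their common distribution. Suppose that $E[f(X)^2]<\infty$, let $\mu_f=E_f[X]=f^{-1}\big(E[f(X)]\big)$ be the $f$-mean of $X$, and let $\sigma_f\ge 0$, with $\sigma_f^2=E\big[(f(X)-f(\mu_f))^2\big]$, be its $f$-standard deviation. Assume that $\sigma_f>0$. Then $\mu_f$ is a well-defined point of $\mathcal I$, that is, $f(\mu_f)=E[f(X)]$, and, with $S_n=\sum_{k=1}^n\big(f(X_k)-f(\mu_f)\big)$, $$Z_n=\frac{1}{\sigma_f\sqrt n}\,S_n\quad\text{converges in distribution to } Z,$$ where $Z$ has the $N(0,1)$ distribution. -/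

import Mathlib

open MeasureTheory ProbabilityTheory Filter

noncomputable section

/-- `X ∈ L_f^p`: the `I`-valued random variable `X` is such that `E[|f(X)|^p] < ∞`. -/
def FMemLp {I : Set ℝ} {Ω : Type*} [MeasurableSpace Ω] (f : I → ℝ) (p : ENNReal)
    (X : Ω → I) (P : Measure Ω) : Prop :=
  MemLp (fun ω => f (X ω)) p P

/-- The `f`-distance `d_f(X, Y) = E[(f(X) - f(Y))^2]^{1/2}` of two `I`-valued random variables. -/
def fDist {I : Set ℝ} {Ω : Type*} [MeasurableSpace Ω] (f : I → ℝ)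
    (X Y : Ω → I) (P : Measure Ω) : ℝ :=
  Real.sqrt (∫ ω, (f (X ω) - f (Y ω)) ^ 2 ∂P)

/-- The `f`-mean `E_f[X] = f⁻¹(E[f(X)])`, an element of `I`. -/
def fMean {I : Set ℝ} [Nonempty I] {Ω : Type*} [MeasurableSpace Ω] (f : I → ℝ)
    (X : Ω → I) (P : Measure Ω) : I :=
  Function.invFun f (∫ ω, f (X ω) ∂P)

/-- The `f`-variance `σ_f²(X) = d_f(X, E_f[X])²`. -/
def fVar {I : Set ℝ} [Nonempty I] {Ω : Type*} [MeasurableSpace Ω] (f : I → ℝ)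
    (X : Ω → I) (P : Measure Ω) : ℝ :=
  fDist f X (fun _ => fMean f X P) P ^ 2

/-- The `f`-standard deviation `σ_f(X)`, the nonnegative square root of the `f`-variance. -/
def fStd {I : Set ℝ} [Nonempty I] {Ω : Type*} [MeasurableSpace Ω] (f : I → ℝ)
    (X : Ω → I) (P : Measure Ω) : ℝ :=
  Real.sqrt (fVar f X P)

end

/-! The variables (f(X_k) - f(μ_f))/σ_f are i.i.d., centred, with second moment 1, so the classical
central limit theorem applies. Centring needs f(μ_f) = E[f(X)]: the expectation lies between two
values of f, and the range of f is an interval by connectedness. -/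

/-- A continuous real function on an interval attains its mean value. -/
theorem integral_mem_range_of_ordConnected {I : Set ℝ} (hI : I.OrdConnected) {f : I → ℝ}
    (hf : Continuous f) {Ω : Type*} [MeasurableSpace Ω] {P : Measure Ω} [IsProbabilityMeasure P]
    {X : Ω → I} (hint : Integrable (fun ω => f (X ω)) P) :
    ∫ ω, f (X ω) ∂P ∈ Set.range f := by
  obtain ⟨a, ha⟩ := exists_le_integral hint
  obtain ⟨b, hb⟩ := exists_integral_le hint
  have : PreconnectedSpace I := Subtype.preconnectedSpace hI.isPreconnected
  exact (isPreconnected_range hf).ordConnected.out ⟨X a, rfl⟩ ⟨X b, rfl⟩ ⟨ha, hb⟩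

theorem apply_fMean_eq_integral {I : Set ℝ} [Nonempty I] (hI : I.OrdConnected) {f : I → ℝ}
    (hf : Continuous f) {Ω : Type*} [MeasurableSpace Ω] {P : Measure Ω} [IsProbabilityMeasure P]
    {X : Ω → I} (hint : Integrable (fun ω => f (X ω)) P) :
    f (fMean f X P) = ∫ ω, f (X ω) ∂P :=
  Function.invFun_eq (integral_mem_range_of_ordConnected hI hf hint)

theorem fStd_sq {I : Set ℝ} [Nonempty I] {Ω : Type*} [MeasurableSpace Ω] (f : I → ℝ)
    (X : Ω → I) (P : Measure Ω) :
    fStd f X P ^ 2 = ∫ ω, (f (X ω) - f (fMean f X P)) ^ 2 ∂P := by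
  rw [fStd, fVar, Real.sq_sqrt (sq_nonneg _), fDist,
    Real.sq_sqrt (integral_nonneg fun _ => sq_nonneg _)]

theorem theorem10 {I : Set ℝ} [Nonempty I] (hI : I.OrdConnected)
    (f : I → ℝ) (hf_cont : Continuous f) (hf_mono : StrictMono f)
    {Ω : Type*} [MeasurableSpace Ω] (P : Measure Ω) [IsProbabilityMeasure P]
    (X : ℕ → Ω → I) (hX : ∀ n, Measurable (X n))
    (hindep : iIndepFun X P) (hident : ∀ n, IdentDistrib (X n) (X 0) P P)
    (hL2 : FMemLp f 2 (X 0) P) (hpos : 0 < fStd f (X 0) P)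
    {Ω' : Type*} [MeasurableSpace Ω'] (P' : Measure Ω') [IsProbabilityMeasure P']
    (Z : Ω' → ℝ) (hZ : HasLaw Z (gaussianReal 0 1) P') :
    f (fMean f (X 0) P) = ∫ ω, f (X 0 ω) ∂P ∧
      TendstoInDistribution
        (fun (n : ℕ) ω => 1 / (fStd f (X 0) P * Real.sqrt n) *
          ∑ k ∈ Finset.range n, (f (X k ω) - f (fMean f (X 0) P)))
        atTop Z (fun _ => P) P' := by
  have hint : Integrable (fun ω => f (X 0 ω)) P := MemLp.integrable one_le_two hL2
  have hmean := apply_fMean_eq_integral hI hf_cont hint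
  refine ⟨hmean, ?_⟩
  have hsq := fStd_sq f (X 0) P
  -- From here `m` and `σ` matter only through `hmean`, `hsq` and `hpos`.
  generalize f (fMean f (X 0) P) = m at *
  generalize fStd f (X 0) P = σ at *
  have hg : Measurable fun x : I => (f x - m) / σ :=
    (hf_cont.measurable.sub_const m).div_const σ
  have key := tendstoInDistribution_inv_sqrt_mul_sum (X := fun k ω => (f (X k ω) - m) / σ) hZ
    (by rw [integral_div, integral_sub hint (integrable_const m)]; simp [hmean])
    (by
      simp only [Pi.pow_apply, div_pow]
      rw [integral_div, ← hsq, div_self (pow_ne_zero 2 hpos.ne')])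
    (hindep.comp (fun _ x => (f x - m) / σ) fun _ => hg)
    (fun k => (hident k).comp hg)
  convert! key using 3 with n ω
  rw [← Finset.sum_div, one_div, mul_inv]
  ring
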